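/- Let $n\ge 2$ and let $P\colon\mathbb{C}^n\to\mathbb{R}$ be a non-constant, plurisubharmonic polynomial in $z,\bar z$ which is homogeneous with respect to real scalars (i.e. there is an integer $d\ge 0$ with $P(tz)=t^dP(z)$ for all $t\in\mathbb{R}$, $z\in\mathbb{C}^n$) and has no pluriharmonic terms, i.e. every monomial $z^\alpha\bar z^\beta$ occurring in $P$ with non-zero coefficient has $\alpha\neq 0$ and $\beta\neq 0$. Assume that there exist a holomorphic function $G\colon\mathbb{C}^n\to\mathbb{C}$ and a non-empty open set $U\subseteq\mathbb{C}^n$ such that the complex derivative of $G$ is non-zero at every point of $U$, and such that $P$ is pluriharmonic along every level set of $G|_U$, i.e. for every $c\in\mathbb{C}$ the restriction of $P$ to the complex submanifold $\{z\in U: G(z)=c\}$ is pluriharmonic (its composition with every holomorphic map from an open subset of $\mathbb{C}$ into this submanifold is harmonic). Then there exist a homogeneous (with respect to real scalars), subharmonic polynomial $s\colon\mathbb{C}\to\mathbb{R}$ in $w,\bar w$ without harmonic terms (i.e. every monomial $w^a\bar w^b$ occurring in $s$ has $a,b\ge 1$) and a homogeneous holomorphic polynomial $h\colon\mathbb{C}^n\to\mathbb{C}$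 such that $P=s\circ h$ on $\mathbb{C}^n$. -/

import Mathlib

open scoped ComplexConjugate

/-- The value at `z ∈ ℂⁿ` of the polynomial `p` in the variables `z₁, …, zₙ` (indexed by `Sum.inl`)
and `z̄₁, …, z̄ₙ` (indexed by `Sum.inr`). -/
noncomputable def evalConj {n : ℕ} (p : MvPolynomial (Fin n ⊕ Fin n) ℂ) (z : Fin n → ℂ) : ℂ :=
  MvPolynomial.eval (Sum.elim z (fun i => conj (z i))) p

/-- `P : ℂⁿ → ℝ` is a (real-valued) polynomial in `z` and `z̄`. -/
def IsPolynomialFun {n : ℕ} (P : (Fin n → ℂ) → ℝ) : Prop :=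
  ∃ p : MvPolynomial (Fin n ⊕ Fin n) ℂ, ∀ z, (P z : ℂ) = evalConj p z

/-- The polynomial `P` has no pluriharmonic terms: every monomial `z ^ α * z̄ ^ β` which occurs in
`P` with a nonzero coefficient has `α ≠ 0` and `β ≠ 0`. (The polynomial `p` in `z, z̄` representing
`P` is unique.) -/
def HasNoPluriharmonicTerms {n : ℕ} (P : (Fin n → ℂ) → ℝ) : Prop :=
  ∃ p : MvPolynomial (Fin n ⊕ Fin n) ℂ, (∀ z, (P z : ℂ) = evalConj p z) ∧
    ∀ m ∈ p.support, (∃ i, m (Sum.inl i) ≠ 0) ∧ (∃ j, m (Sum.inr j) ≠ 0)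

/-- `P` is homogeneous (of some degree) with respect to real scalars. -/
def IsRealHomogeneous {n : ℕ} (P : (Fin n → ℂ) → ℝ) : Prop :=
  ∃ d : ℕ, ∀ (t : ℝ) (z : Fin n → ℂ), P ((t : ℂ) • z) = t ^ d * P z

/-- A real-valued function on `ℂ` is subharmonic: it is upper semicontinuous and satisfies the
sub-mean value inequality on every circle. -/
def IsSubharmonic (u : ℂ → ℝ) : Prop :=
  UpperSemicontinuous u ∧ ∀ (c : ℂ) (r : ℝ), 0 < r →
    CircleIntegrable u c r ∧ u c ≤ Real.circleAverage u c r

/-- A real-valued function on `ℂⁿ` is plurisubharmonic: it is upper semicontinuous and subharmonic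
on every complex line. -/
def IsPlurisubharmonic {n : ℕ} (P : (Fin n → ℂ) → ℝ) : Prop :=
  UpperSemicontinuous P ∧ ∀ z w : Fin n → ℂ, IsSubharmonic (fun ζ : ℂ => P (z + ζ • w))

/-- `P` is pluriharmonic along the complex submanifold `S` of (an open subset of) `ℂⁿ`:
the composition of `P` with every holomorphic curve in `S` is harmonic. -/
def IsPluriharmonicAlong {n : ℕ} (P : (Fin n → ℂ) → ℝ) (S : Set (Fin n → ℂ)) : Prop :=
  ∀ (V : Set ℂ) (φ : ℂ → Fin n → ℂ), IsOpen V → DifferentiableOn ℂ φ V → Set.MapsTo φ V S →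
    InnerProductSpace.HarmonicOnNhd (fun ζ => P (φ ζ)) V

/-- A function of one complex variable, viewed as a function on `ℂ¹`. -/
def toFinOne (s : ℂ → ℝ) : (Fin 1 → ℂ) → ℝ := fun w => s (w 0)

/-! Write `P(z) = ∑ q_β(z) conj(z^β)` with `q_β` holomorphic and homogeneous. If `dG(v) = 0` at a
point of `U`, some holomorphic curve in the level set of `G` has tangent `v`, and harmonicity of `P`
along it says that the Levi form vanishes on `(v, v)`. Plurisubharmonicity makes the Levi form
positive semidefinite, so `v` lies in its kernel.

Choosing `v = ∂_l G e_j - ∂_j G e_l`, which depends holomorphically on `z`, turns this into an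
identity on `U` that polarizes: `conj z` may be replaced by an independent variable `η`. Comparing
coefficients of `η^β` gives `dq_β ∧ dG = 0` (`fderiv_mul_pderiv_eq`), so the gradients of all `q_β`
are pairwise proportional.

For homogeneous polynomials Euler's identity upgrades this to `q_β ^ b = c * q_β' ^ a`, with `a`,
`b` the degrees of `q_β`, `q_β'` (`IsHomogeneous.exists_pow_eq_C_mul_pow`). Unique factorization
then produces one homogeneous `h` with every `q_β` a multiple of a power of `h`
(`exists_common_root`).

As `P` is real, its polarization is Hermitian symmetric, so `P` is constant on the fibres of `h`.
The factor `s` is read off on a line `ζ ↦ ζ w₀` with `h(w₀) = 1`, where `h` becomes `ζ ^ e`.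
Invariance under `e`-th roots of unity makes `s` a polynomial in `w, conj w`, and its Laplacian
inherits nonnegativity from `P` (`exists_factorization_of_common_root`). -/

/-! ### Entire functions: smoothness and curves in level sets. -/

section EntireFunctions

variable {E : Type*} [NormedAddCommGroup E] [NormedSpace ℂ E] {G : E → ℂ}

/-- Cauchy's formula for the directional derivative of an entire function. -/
theorem Differentiable.fderiv_apply_eq_integral (hG : Differentiable ℂ G) (z v : E) :
    fderiv ℂ G z v = (2 * Real.pi * Complex.I)⁻¹ * ∫ θ in (0 : ℝ)..2 * Real.pi,
      _root_.deriv (circleMap 0 1) θ * ((1 / (circleMap 0 1 θ) ^ 2) * G (z + circleMap 0 1 θ • v)) := by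
  have hd : Differentiable ℂ (fun ζ : ℂ => G (z + ζ • v)) := hG.comp (by fun_prop)
  have h := (hd.differentiableOn (s := Metric.closedBall 0 1)).deriv_eq_smul_circleIntegral one_pos
  have h2 : _root_.deriv (fun ζ : ℂ => G (z + ζ • v)) 0 = fderiv ℂ G z v := by
    have h3 : HasDerivAt (fun ζ : ℂ => z + ζ • v) v 0 := by
      simpa using ((hasDerivAt_id (0 : ℂ)).smul_const v).const_add z
    have h4 := (hG (z + (0 : ℂ) • v)).hasFDerivAt.comp_hasDerivAt (0 : ℂ) h3
    simpa [Function.comp_def] using h4.deriv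
  rw [h2] at h
  simp only [circleIntegral, sub_zero, smul_eq_mul] at h
  rw [h, ← mul_assoc, inv_mul_cancel₀ (by simp [Real.pi_ne_zero]), one_mul]

theorem Differentiable.continuous_fderiv_apply (hG : Differentiable ℂ G) (v : E) :
    Continuous fun z => fderiv ℂ G z v := by
  simp_rw [hG.fderiv_apply_eq_integral _ v]
  refine continuous_const.mul
    (intervalIntegral.continuous_parametric_intervalIntegral_of_continuous' ?_ _ _)
  have := hG.continuous
  simp only [deriv_circleMap]
  unfold Function.uncurry
  refine ((Continuous.mul (by fun_prop) continuous_const)).mul (Continuous.mul ?_ (by fun_prop))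
  exact continuous_const.div (by fun_prop) (fun a => pow_ne_zero _ (circleMap_ne_center one_ne_zero))

theorem Differentiable.contDiff_one [FiniteDimensional ℂ E] (hG : Differentiable ℂ G) :
    ContDiff ℂ 1 G :=
  contDiff_one_iff_fderiv.2 ⟨hG, continuous_clm_apply.2 hG.continuous_fderiv_apply⟩

/-- Directional derivatives of an entire function are holomorphic along complex lines. -/
theorem Differentiable.differentiable_fderiv_line (hG : Differentiable ℂ G) (z a v : E) :
    Differentiable ℂ fun s : ℂ => fderiv ℂ G (z + s • a) v := by
  intro s₀
  simp_rw [hG.fderiv_apply_eq_integral _ v]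
  refine DifferentiableAt.const_mul ?_ _
  have hc : Continuous fun q : ℂ × ℝ => fderiv ℂ G (z + q.1 • a + circleMap 0 1 q.2 • v) a :=
    (hG.continuous_fderiv_apply a).comp (by fun_prop)
  have hc0 : Continuous fun q : ℂ × ℝ => G (z + q.1 • a + circleMap 0 1 q.2 • v) :=
    hG.continuous.comp (by fun_prop)
  have hk : Continuous fun θ : ℝ => _root_.deriv (circleMap 0 1) θ * (1 / (circleMap 0 1 θ) ^ 2) := by
    simp only [deriv_circleMap]
    exact Continuous.mul (by fun_prop) (continuous_const.div (by fun_prop)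
      fun a => pow_ne_zero _ (circleMap_ne_center one_ne_zero))
  set F' : ℂ → ℝ → ℂ := fun s θ => _root_.deriv (circleMap 0 1) θ *
    ((1 / (circleMap 0 1 θ) ^ 2) * fderiv ℂ G (z + s • a + circleMap 0 1 θ • v) a) with hF'
  have hF'c : Continuous fun q : ℂ × ℝ => F' q.1 q.2 := by
    have := (hk.comp continuous_snd).mul hc
    simpa [hF', mul_assoc, Function.comp_def, Pi.mul_def] using this
  -- Compactness in `(s, θ)` gives the uniform bound needed to differentiate Cauchy's formula under
  -- the integral.
  obtain ⟨C, hC⟩ := ((isCompact_closedBall s₀ 1).prod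
    (isCompact_Icc (a := (0 : ℝ)) (b := 2 * Real.pi))).exists_bound_of_continuousOn
    hF'c.continuousOn
  have hFc : ∀ s : ℂ, Continuous fun θ : ℝ => _root_.deriv (circleMap 0 1) θ *
    ((1 / (circleMap 0 1 θ) ^ 2) * G (z + s • a + circleMap 0 1 θ • v)) := fun s => by
    have := hk.mul (hc0.comp (Continuous.prodMk continuous_const continuous_id) : Continuous
      fun θ : ℝ => G (z + s • a + circleMap 0 1 θ • v))
    simpa [mul_assoc, Function.comp_def, Pi.mul_def] using this
  refine (intervalIntegral.hasDerivAt_integral_of_dominated_loc_of_deriv_le (F' := F')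
    (bound := fun _ => C) (Metric.closedBall_mem_nhds s₀ one_pos)
    (Filter.Eventually.of_forall fun s => (hFc s).aestronglyMeasurable)
    ((hFc s₀).intervalIntegrable _ _) ?_ ?_ (by simp) ?_).2.differentiableAt
  · exact (hF'c.comp (Continuous.prodMk continuous_const continuous_id) : Continuous
      fun θ : ℝ => F' s₀ θ).aestronglyMeasurable
  · refine Filter.Eventually.of_forall fun θ hθ s hs => hC (s, θ) ⟨hs, ?_⟩
    rw [Set.uIoc_of_le Real.two_pi_pos.le] at hθ
    exact ⟨hθ.1.le, hθ.2⟩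
  · refine Filter.Eventually.of_forall fun θ _ s _ => ?_
    refine ((?_ : HasDerivAt _ _ s).const_mul _).const_mul _
    have h3 : HasDerivAt (fun s : ℂ => z + s • a + circleMap 0 1 θ • v) a s := by
      simpa using (((hasDerivAt_id s).smul_const a).const_add z).add_const (circleMap 0 1 θ • v)
    exact (hG _).hasFDerivAt.comp_hasDerivAt s h3

/-- Through every point where the derivative of an entire function `G` does not vanish, and for
every direction in its kernel, there is a holomorphic curve in the level set of `G`. -/
theorem Differentiable.exists_curve_in_level_set [FiniteDimensional ℂ E]
    (hG : Differentiable ℂ G) {z v : E} (hz : fderiv ℂ G z ≠ 0) (hv : fderiv ℂ G z v = 0)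
    {U : Set E} (hU : IsOpen U) (hzU : z ∈ U) :
    ∃ (V : Set ℂ) (φ : ℂ → E), IsOpen V ∧ 0 ∈ V ∧ DifferentiableOn ℂ φ V ∧
      (∀ ζ ∈ V, φ ζ ∈ U ∧ G (φ ζ) = G z) ∧ φ 0 = z ∧ HasDerivAt φ v 0 := by
  have : CompleteSpace E := FiniteDimensional.complete ℂ E
  set ℓ := fderiv ℂ G z with hℓ
  obtain ⟨w₀, hw₀⟩ : ∃ w, ℓ w ≠ 0 := by
    by_contra! h
    exact hz (ContinuousLinearMap.ext h)
  set w := (ℓ w₀)⁻¹ • w₀ with hw_def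
  have hw : ℓ w = 1 := by simp [hw_def, hw₀]
  -- `Ψ` straightens `G`: `ℓ ∘ Ψ = G` and `Ψ` has derivative `id` at `z`. Its local inverse
  -- therefore carries the line `Ψ z + ζ v`, on which `ℓ` is constant, to the desired curve.
  set Ψ : E → E := fun x => x + (G x - ℓ x) • w with hΨ
  have hΨc : ContDiff ℂ 1 Ψ :=
    contDiff_id.add ((hG.contDiff_one.sub ℓ.contDiff).smul contDiff_const)
  have hΨd : HasFDerivAt Ψ ((ContinuousLinearEquiv.refl ℂ E : E ≃L[ℂ] E) : E →L[ℂ] E) z := by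
    have h1 := (hasFDerivAt_id (𝕜 := ℂ) z).add
      (((hG z).hasFDerivAt.sub ℓ.hasFDerivAt).smul_const w)
    refine h1.congr_fderiv ?_
    ext x
    simp [hℓ]
  have hℓΨ : ∀ x, ℓ (Ψ x) = G x := fun x => by simp [hΨ, hw]
  have hca := hΨc.contDiffAt (x := z)
  set inv := hca.localInverse hΨd one_ne_zero with hinv
  have hstr := hca.hasStrictFDerivAt' hΨd one_ne_zero
  have hright : ∀ᶠ y in nhds (Ψ z), Ψ (inv y) = y := hstr.eventually_right_inverse
  have hinvc : ContDiffAt ℂ 1 inv (Ψ z) := hca.to_localInverse hΨd one_ne_zero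
  have hinvz : inv (Ψ z) = z := hca.localInverse_apply_image hΨd one_ne_zero
  have hinvd : HasFDerivAt inv (((ContinuousLinearEquiv.refl ℂ E : E ≃L[ℂ] E).symm : E ≃L[ℂ] E) : E →L[ℂ] E) (Ψ z) :=
    hstr.to_localInverse.hasFDerivAt
  have hev : ∀ᶠ y in nhds (Ψ z), Ψ (inv y) = y ∧ DifferentiableAt ℂ inv y ∧ inv y ∈ U := by
    refine hright.and (Filter.Eventually.and ?_ ?_)
    · filter_upwards [hinvc.eventually (by simp)] with y hy
      exact hy.differentiableAt one_ne_zero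
    · exact hinvc.continuousAt.eventually (by rw [hinvz]; exact hU.mem_nhds hzU)
  obtain ⟨W, hW, hWo, hzW⟩ := eventually_nhds_iff.1 hev
  have hlin : Continuous fun ζ : ℂ => Ψ z + ζ • v := by fun_prop
  have h3 : ∀ ζ : ℂ, HasDerivAt (fun ζ : ℂ => Ψ z + ζ • v) v ζ := fun ζ => by
    simpa using ((hasDerivAt_id ζ).smul_const v).const_add (Ψ z)
  refine ⟨(fun ζ : ℂ => Ψ z + ζ • v) ⁻¹' W, fun ζ => inv (Ψ z + ζ • v), hWo.preimage hlin,
    by simpa using hzW, ?_, ?_, by simp [hinvz], ?_⟩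
  · intro ζ hζ
    exact ((hW _ hζ).2.1.comp ζ (h3 ζ).differentiableAt).differentiableWithinAt
  · intro ζ hζ
    obtain ⟨h4, -, h5⟩ := hW _ hζ
    refine ⟨h5, ?_⟩
    rw [← hℓΨ, h4, map_add, hℓΨ, map_smul, hv, smul_zero, add_zero]
  · have h6 : HasFDerivAt inv (((ContinuousLinearEquiv.refl ℂ E : E ≃L[ℂ] E).symm : E ≃L[ℂ] E) : E →L[ℂ] E) (Ψ z + (0 : ℂ) • v) := by
      simpa using hinvd
    have h7 := h6.comp_hasDerivAt (0 : ℂ) (h3 0)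
    rwa [ContinuousLinearEquiv.coe_coe, ContinuousLinearEquiv.refl_symm, ContinuousLinearEquiv.coe_refl'] at h7

end EntireFunctions

/-! ### Identity theorems and polarization. -/

/-- An entire function of one variable vanishing near `0` on the real axis vanishes. -/
theorem Complex.eq_zero_of_eventually_real {f : ℂ → ℂ} (hf : Differentiable ℂ f)
    (h : ∀ᶠ t : ℝ in nhds 0, f t = 0) : ∀ ζ, f ζ = 0 := by
  have h1 : ∃ᶠ ζ in nhdsWithin (0 : ℂ) {0}ᶜ, f ζ = 0 := by
    have h2 : Filter.Tendsto (fun t : ℝ => (t : ℂ)) (nhdsWithin 0 {0}ᶜ) (nhdsWithin 0 {0}ᶜ) := by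
      refine tendsto_nhdsWithin_of_tendsto_nhds_of_eventually_within _ ?_ ?_
      · exact (Complex.continuous_ofReal.tendsto' 0 0 rfl).mono_left nhdsWithin_le_nhds
      · filter_upwards [self_mem_nhdsWithin] with t ht
        simpa using ht
    exact h2.frequently ((h.filter_mono nhdsWithin_le_nhds).frequently)
  have := AnalyticOnNhd.eq_of_frequently_eq (f := f) (g := fun _ => 0)
    (fun z _ => hf.analyticAt z) (fun z _ => analyticAt_const) h1
  exact fun ζ => congrFun this ζ

/-- Polarization: a function of `(z, η)` which is separately entire along complex lines and
vanishes on `η = conj z` for `z` in a nonempty open set vanishes identically. -/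
theorem eq_zero_of_vanish_on_antidiagonal {n : ℕ} {F : (Fin n → ℂ) → (Fin n → ℂ) → ℂ}
    (hF : ∀ z η a b, Differentiable ℂ fun s : ℂ => F (z + s • a) (η + s • b))
    {U : Set (Fin n → ℂ)} (hU : IsOpen U) (hne : U.Nonempty)
    (h : ∀ z ∈ U, F z (fun i => conj (z i)) = 0) (z η : Fin n → ℂ) : F z η = 0 := by
  obtain ⟨z₀, hz₀⟩ := hne
  -- Chosen so that `(s, t) = (1, i)` yields `(z, η)`, while real `(s, t)` stay on the antidiagonal
  -- `η = conj z`. The one-variable identity theorem is then applied in `s` and afterwards in `t`.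
  set a : Fin n → ℂ := fun i => ((z i - z₀ i) + (conj (η i) - z₀ i)) / 2 with ha
  set b : Fin n → ℂ := fun i => ((z i - z₀ i) - (conj (η i) - z₀ i)) / (2 * Complex.I) with hb
  set H : ℂ → ℂ → ℂ := fun s t => F (z₀ + s • a + t • b)
    ((fun i => conj (z₀ i)) + s • (fun i => conj (a i)) + t • (fun i => conj (b i))) with hH
  have hs : ∀ t, Differentiable ℂ fun s => H s t := fun t => by
    have := hF (z₀ + t • b) ((fun i => conj (z₀ i)) + t • (fun i => conj (b i))) a
      (fun i => conj (a i))
    simpa only [hH, add_right_comm] using this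
  have ht : ∀ s, Differentiable ℂ fun t => H s t := fun s => hF _ _ _ _
  have hreal : ∀ᶠ q : ℝ × ℝ in nhds (0, 0), H q.1 q.2 = 0 := by
    have hc : Continuous fun q : ℝ × ℝ => z₀ + (q.1 : ℂ) • a + (q.2 : ℂ) • b := by fun_prop
    have := hc.continuousAt.eventually_mem (x := (0, 0)) (hU.mem_nhds (by simpa using hz₀))
    filter_upwards [this] with q hq
    convert h _ hq using 2
    ext i
    simp
  rw [nhds_prod_eq] at hreal
  have h1 : ∀ᶠ t : ℝ in nhds 0, ∀ s, H s t = 0 := by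
    filter_upwards [(Filter.eventually_swap_iff.1 hreal).curry] with t h
    exact Complex.eq_zero_of_eventually_real (hs t) h
  have h2 : H 1 Complex.I = 0 := by
    refine Complex.eq_zero_of_eventually_real (ht 1) ?_ _
    filter_upwards [h1] with t h using h 1
  convert h2 using 2
  · ext i
    simp [ha, hb]
    field_simp
    ring
  · ext i
    simp [ha, hb, map_ofNat]
    field_simp
    ring

/-! ### Circle averages of polynomials in `ζ, conj ζ`. -/

section CircleAverages

open Polynomial

theorem circleAverage_pow_mul_conj_pow (j k : ℕ) (r : ℝ) :
    Real.circleAverage (fun ζ : ℂ => ζ ^ j * conj ζ ^ k) 0 r =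
      if j = k then (r : ℂ) ^ (2 * j) else 0 := by
  have h1 : ∀ θ : ℝ, (circleMap 0 r θ) ^ j * conj (circleMap 0 r θ) ^ k =
      (r : ℂ) ^ (j + k) * Complex.exp ((((j : ℤ) - k : ℤ) : ℂ) * Complex.I * θ) := by
    intro θ
    simp only [circleMap, zero_add, map_mul, Complex.conj_ofReal, ← Complex.exp_conj, mul_pow,
      ← Complex.exp_nat_mul, Complex.conj_I]
    rw [mul_mul_mul_comm, ← pow_add, ← Complex.exp_add]
    congr 2
    push_cast
    ring
  simp only [Real.circleAverage, h1]
  split_ifs with h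
  · subst h
    have : (Real.pi : ℂ) ≠ 0 := by simp [Real.pi_ne_zero]
    simp [← two_mul]
    field_simp
  · have h2 : (((j : ℤ) - k : ℤ) : ℂ) * Complex.I ≠ 0 := by
      refine mul_ne_zero ?_ Complex.I_ne_zero
      rw [Int.cast_ne_zero]
      omega
    have h3 : Complex.exp ((((j : ℤ) - k : ℤ) : ℂ) * Complex.I * ((2 * Real.pi : ℝ) : ℂ)) = 1 := by
      rw [← Complex.exp_int_mul_two_pi_mul_I ((j : ℤ) - k)]
      congr 1
      push_cast
      ring
    rw [intervalIntegral.integral_const_mul, integral_exp_mul_complex h2, h3]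
    simp

variable {ι : Type*} (B : Finset ι) (F H : ι → ℂ[X])

theorem continuous_sum_eval_mul_conj :
    Continuous fun ζ : ℂ => ∑ i ∈ B, (F i).eval ζ * conj ((H i).eval ζ) :=
  continuous_finsetSum _ fun i _ =>
    (F i).continuous.mul (Complex.continuous_conj.comp (H i).continuous)

/-- Orthogonality of the characters of the circle leaves only the diagonal terms `ζ ^ k * conj ζ ^
k`. -/
theorem circleAverage_sum_eval_mul_conj {N : ℕ}
    (hN : ∀ i ∈ B, (F i).natDegree < N ∧ (H i).natDegree < N) (r : ℝ) :
    Real.circleAverage (fun ζ : ℂ => ∑ i ∈ B, (F i).eval ζ * conj ((H i).eval ζ)) 0 r =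
      ∑ k ∈ Finset.range N, (∑ i ∈ B, (F i).coeff k * conj ((H i).coeff k)) * (r : ℂ) ^ (2 * k) := by
  have hci : ∀ (f : ℂ → ℂ), Continuous f → CircleIntegrable f 0 r := fun f hf =>
    hf.continuousOn.circleIntegrable'
  have h1 : ∀ i ∈ B, ∀ ζ : ℂ, (F i).eval ζ * conj ((H i).eval ζ) =
      ∑ j ∈ Finset.range N, ∑ k ∈ Finset.range N,
        ((F i).coeff j * conj ((H i).coeff k)) • (ζ ^ j * conj ζ ^ k) := by
    intro i hi ζ
    rw [eval_eq_sum_range' (hN i hi).1, eval_eq_sum_range' (hN i hi).2, map_sum,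
      Finset.sum_mul_sum]
    refine Finset.sum_congr rfl fun j _ => Finset.sum_congr rfl fun k _ => ?_
    simp only [map_mul, map_pow, smul_eq_mul]
    ring
  have hci' : ∀ i ∈ B, CircleIntegrable (fun ζ => (F i).eval ζ * conj ((H i).eval ζ)) 0 r :=
    fun i _ => hci _ ((F i).continuous.mul (Complex.continuous_conj.comp (H i).continuous))
  rw [Real.circleAverage_fun_sum hci']
  simp_rw [Finset.sum_mul]
  rw [Finset.sum_comm]
  refine Finset.sum_congr rfl fun i hi => ?_
  simp_rw [h1 i hi]
  rw [Real.circleAverage_fun_sum fun j _ => hci _ (by fun_prop)]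
  refine Finset.sum_congr rfl fun j hj => ?_
  rw [Real.circleAverage_fun_sum fun k _ => hci _ (by fun_prop)]
  simp_rw [Real.circleAverage_fun_smul, circleAverage_pow_mul_conj_pow]
  simp [Finset.mem_range.1 hj]

theorem exists_natDegree_bound :
    ∃ N, 1 < N ∧ ∀ i ∈ B, (F i).natDegree < N ∧ (H i).natDegree < N := by
  refine ⟨B.sup (fun i => (F i).natDegree + (H i).natDegree) + 2, by omega, fun i hi => ?_⟩
  have := Finset.le_sup (f := fun i => (F i).natDegree + (H i).natDegree) hi
  omega

theorem circleAverage_ofReal {u : ℂ → ℝ} (hu : Continuous u) (c : ℂ) (r : ℝ) :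
    ((Real.circleAverage u c r : ℝ) : ℂ) = Real.circleAverage (fun ζ => (u ζ : ℂ)) c r :=
  (Complex.ofRealCLM.circleAverage_comp_comm hu.continuousOn.circleIntegrable').symm

variable {B F H}

theorem continuous_of_ofReal_eq_sum {u : ℂ → ℝ}
    (hu : ∀ ζ, (u ζ : ℂ) = ∑ i ∈ B, (F i).eval ζ * conj ((H i).eval ζ)) : Continuous u := by
  have : u = fun ζ => (∑ i ∈ B, (F i).eval ζ * conj ((H i).eval ζ)).re := by
    ext ζ
    rw [← hu, Complex.ofReal_re]
  rw [this]
  exact Complex.continuous_re.comp (continuous_sum_eval_mul_conj B F H)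

/-- The mixed second order coefficient of a real polynomial in `ζ, conj ζ` with the sub-mean value
property at `0` is a nonnegative real number. -/
theorem mixed_coeff_nonneg_of_subMean {u : ℂ → ℝ}
    (hu : ∀ ζ, (u ζ : ℂ) = ∑ i ∈ B, (F i).eval ζ * conj ((H i).eval ζ))
    (hsub : ∀ r : ℝ, 0 < r → u 0 ≤ Real.circleAverage u 0 r) :
    0 ≤ (∑ i ∈ B, (F i).coeff 1 * conj ((H i).coeff 1)).re ∧
      (∑ i ∈ B, (F i).coeff 1 * conj ((H i).coeff 1)).im = 0 := by
  obtain ⟨N, hN1, hN⟩ := exists_natDegree_bound B F H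
  set C : ℕ → ℂ := fun k => ∑ i ∈ B, (F i).coeff k * conj ((H i).coeff k) with hC
  have h0 : (u 0 : ℂ) = C 0 := by simp [hu, hC, coeff_zero_eq_eval_zero]
  -- `g r` is the mean-value excess divided by `r ^ 2`; it is real and nonnegative for `r > 0` and
  -- tends to the mixed coefficient as `r → 0`.
  set g : ℝ → ℂ := fun r => ∑ k ∈ Finset.range (N - 1), C (k + 1) * (r : ℂ) ^ (2 * k) with hg
  have havg : ∀ r : ℝ, ((Real.circleAverage u 0 r - u 0 : ℝ) : ℂ) = (r : ℂ) ^ 2 * g r := by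
    intro r
    have h2 := circleAverage_sum_eval_mul_conj B F H hN r
    rw [Complex.ofReal_sub, circleAverage_ofReal (continuous_of_ofReal_eq_sum hu)]
    simp_rw [hu] at h0 ⊢
    rw [h2, h0]
    obtain ⟨M, rfl⟩ : ∃ M, N = M + 1 := ⟨N - 1, by omega⟩
    rw [Finset.sum_range_succ']
    simp only [hg, add_tsub_cancel_right, Finset.mul_sum, mul_zero, pow_zero, mul_one, hC,
      add_sub_cancel_right]
    exact Finset.sum_congr rfl fun k _ => by ring
  have hS : IsClosed {x : ℂ | 0 ≤ x.re ∧ x.im = 0} :=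
    (isClosed_le continuous_const Complex.continuous_re).inter
      (isClosed_eq Complex.continuous_im continuous_const)
  have hgc : Continuous g := by fun_prop
  have hg0 : g 0 = C 1 := by
    obtain ⟨M, rfl⟩ : ∃ M, N = M + 2 := ⟨N - 2, by omega⟩
    simp only [hg]
    rw [show M + 2 - 1 = M + 1 by omega, Finset.sum_range_succ']
    simp
  have hlim : Filter.Tendsto g (nhdsWithin 0 (Set.Ioi 0)) (nhds (C 1)) :=
    hg0 ▸ hgc.continuousAt.tendsto.mono_left nhdsWithin_le_nhds
  refine hS.mem_of_tendsto hlim ?_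
  filter_upwards [self_mem_nhdsWithin] with r hr
  have hr : 0 < r := hr
  have h3 : g r = (((Real.circleAverage u 0 r - u 0) / r ^ 2 : ℝ) : ℂ) := by
    rw [Complex.ofReal_div, havg, Complex.ofReal_pow, mul_div_cancel_left₀]
    exact pow_ne_zero _ (by exact_mod_cast hr.ne')
  simp only [h3, Complex.ofReal_re, Complex.ofReal_im, and_true]
  exact div_nonneg (sub_nonneg.2 (hsub r hr)) (sq_nonneg r)

/-- In the variable `t = r ^ 2` the radial Laplacian is `4 (t a')'`. Integrating its sign once gives
`t a' ≥ 0`, and once more that `a` increases. -/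
theorem Polynomial.eval_zero_le_of_derivative_nonneg {a : ℝ[X]}
    (h : ∀ t : ℝ, 0 < t → 0 ≤ (derivative (X * derivative a)).eval t) {t : ℝ} (ht : 0 ≤ t) :
    a.eval 0 ≤ a.eval t := by
  have key : ∀ b : ℝ[X], (∀ t : ℝ, 0 < t → 0 ≤ (derivative b).eval t) →
      ∀ t : ℝ, 0 ≤ t → b.eval 0 ≤ b.eval t := by
    intro b hb t ht
    refine monotoneOn_of_deriv_nonneg (convex_Ici 0) b.continuous.continuousOn
      b.differentiable.differentiableOn ?_ Set.self_mem_Ici ht ht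
    intro x hx
    rw [interior_Ici] at hx
    rw [Polynomial.deriv]
    exact hb x hx
  refine key a (fun t ht => ?_) t ht
  have := key _ h t ht.le
  simp only [eval_mul, eval_X, zero_mul] at this
  exact nonneg_of_mul_nonneg_right this ht

/-- A real polynomial in `ζ, conj ζ` with nonnegative Laplacian has the sub-mean value property. -/
theorem subMean_of_laplacian_nonneg {u : ℂ → ℝ}
    (hu : ∀ ζ, (u ζ : ℂ) = ∑ i ∈ B, (F i).eval ζ * conj ((H i).eval ζ))
    (hlap : ∀ ζ : ℂ,
      0 ≤ (∑ i ∈ B, (derivative (F i)).eval ζ * conj ((derivative (H i)).eval ζ)).re)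
    (r : ℝ) : u 0 ≤ Real.circleAverage u 0 r := by
  obtain ⟨N, hN1, hN⟩ := exists_natDegree_bound B F H
  set C : ℕ → ℂ := fun k => ∑ i ∈ B, (F i).coeff k * conj ((H i).coeff k) with hC
  have hN' : ∀ i ∈ B, (derivative (F i)).natDegree < N ∧ (derivative (H i)).natDegree < N :=
    fun i hi => ⟨(natDegree_derivative_le _).trans_lt (by have := (hN i hi).1; omega),
      (natDegree_derivative_le _).trans_lt (by have := (hN i hi).2; omega)⟩
  set a : ℝ[X] := ∑ k ∈ Finset.range N, Polynomial.C (C k).re * X ^ k with ha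
  have havg : ∀ ρ : ℝ, Real.circleAverage u 0 ρ = a.eval (ρ ^ 2) := by
    intro ρ
    have h1 : ((Real.circleAverage u 0 ρ : ℝ) : ℂ) = _ :=
      circleAverage_ofReal (continuous_of_ofReal_eq_sum hu) 0 ρ
    simp_rw [hu] at h1
    rw [circleAverage_sum_eval_mul_conj B F H hN] at h1
    have h2 := congrArg Complex.re h1
    rw [Complex.ofReal_re] at h2
    rw [h2, ha, eval_finsetSum, Complex.re_sum]
    refine Finset.sum_congr rfl fun k _ => ?_
    rw [← Complex.ofReal_pow, Complex.re_mul_ofReal]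
    simp only [← pow_mul, eval_mul, eval_C, eval_pow, eval_X, hC]
  -- With `a(ρ ^ 2)` the average of `u`, the value of `(t a')'` at `ρ ^ 2` is the real part of the
  -- average of `∂∂̄u`; both have coefficients `(k + 1) ^ 2 * Re C (k + 1)`.
  have hlap' : ∀ ρ : ℝ, 0 ≤ (derivative (X * derivative a)).eval (ρ ^ 2) := by
    intro ρ
    have h1 := circleAverage_sum_eval_mul_conj B (fun i => derivative (F i))
      (fun i => derivative (H i)) hN' ρ
    have hcont := continuous_sum_eval_mul_conj B (fun i => derivative (F i))
      (fun i => derivative (H i))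
    have h2 := Complex.reCLM.circleAverage_comp_comm (f := fun ζ : ℂ => ∑ i ∈ B,
      (derivative (F i)).eval ζ * conj ((derivative (H i)).eval ζ)) (c := 0) (R := ρ)
      hcont.continuousOn.circleIntegrable'
    have h3 : 0 ≤ Real.circleAverage (Complex.reCLM ∘ fun ζ : ℂ => ∑ i ∈ B,
        (derivative (F i)).eval ζ * conj ((derivative (H i)).eval ζ)) 0 ρ :=
      Real.circleAverage_nonneg_of_nonneg fun ζ _ => hlap ζ
    rw [h2, h1, Complex.reCLM_apply, Complex.re_sum] at h3
    convert h3 using 1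
    obtain ⟨M, rfl⟩ : ∃ M, N = M + 1 := ⟨N - 1, by omega⟩
    have hlast : ∑ i ∈ B, (derivative (F i)).coeff M * conj ((derivative (H i)).coeff M) = 0 :=
      Finset.sum_eq_zero fun i hi => by
        rw [coeff_derivative, coeff_eq_zero_of_natDegree_lt (hN i hi).1, zero_mul, zero_mul]
    rw [Finset.sum_range_succ, hlast, zero_mul, Complex.zero_re, add_zero, ha,
      Finset.sum_range_succ', derivative_add, derivative_sum, mul_add, Finset.mul_sum,
      derivative_add, derivative_sum, eval_add, eval_finsetSum]
    simp only [pow_zero, mul_one, derivative_C, mul_zero, derivative_zero, eval_zero, add_zero]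
    refine Finset.sum_congr rfl fun k _ => ?_
    have h4 : ∑ i ∈ B, (derivative (F i)).coeff k * conj ((derivative (H i)).coeff k) =
        (((k + 1 : ℝ) ^ 2 : ℝ) : ℂ) * C (k + 1) := by
      rw [hC, Finset.mul_sum]
      refine Finset.sum_congr rfl fun i _ => ?_
      simp only [coeff_derivative, map_mul, map_add, map_natCast, map_one]
      push_cast
      ring
    rw [h4, ← Complex.ofReal_pow, Complex.re_mul_ofReal, Complex.re_ofReal_mul]
    simp only [derivative_mul, derivative_C, derivative_X_pow, derivative_X, zero_mul, zero_add,
      add_tsub_cancel_right, eval_add, eval_mul, eval_C, eval_pow, eval_X, one_mul, Nat.cast_add,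
      Nat.cast_one]
    rcases k with _ | k
    · simp
    · simp
      ring
  have h0 : u 0 = a.eval 0 := by
    have := havg 0
    simpa using this
  rw [h0, havg]
  refine Polynomial.eval_zero_le_of_derivative_nonneg (fun t ht => ?_) (sq_nonneg r)
  simpa [Real.sq_sqrt ht.le] using hlap' (Real.sqrt t)

end CircleAverages

/-! ### The Laplacian along a holomorphic curve. -/

section Laplacian

open InnerProductSpace

theorem hasFDerivAt_mul_conj {f h : ℂ → ℂ} {ζ : ℂ} (hf : DifferentiableAt ℂ f ζ)
    (hh : DifferentiableAt ℂ h ζ) :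
    HasFDerivAt (𝕜 := ℝ) (fun x => f x * conj (h x))
      ((f ζ * conj (deriv h ζ)) • (Complex.conjCLE : ℂ →L[ℝ] ℂ) +
        (deriv f ζ * conj (h ζ)) • (1 : ℂ →L[ℝ] ℂ)) ζ := by
  have h1 := hf.hasDerivAt.complexToReal_fderiv
  have h2 := (Complex.conjCLE : ℂ →L[ℝ] ℂ).hasFDerivAt.comp ζ hh.hasDerivAt.complexToReal_fderiv
  refine (h1.mul h2).congr_fderiv ?_
  ext v
  all_goals
    simp
    ring

/-- The Laplacian of `∑ fᵢ * conj hᵢ` for holomorphic `fᵢ`, `hᵢ`. -/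
theorem sum_deriv_mul_conj_deriv_eq_zero_of_harmonicAt {ι : Type*} {B : Finset ι}
    {f h : ι → ℂ → ℂ} {ζ₀ : ℂ} {u : ℂ → ℝ}
    (hf : ∀ i ∈ B, AnalyticAt ℂ (f i) ζ₀) (hh : ∀ i ∈ B, AnalyticAt ℂ (h i) ζ₀)
    (hu : ∀ᶠ ζ in nhds ζ₀, (u ζ : ℂ) = ∑ i ∈ B, f i ζ * conj (h i ζ))
    (hharm : HarmonicAt u ζ₀) :
    ∑ i ∈ B, deriv (f i) ζ₀ * conj (deriv (h i) ζ₀) = 0 := by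
  set w : ℂ → ℂ := fun ζ => ∑ i ∈ B, f i ζ * conj (h i ζ) with hw
  have hharm2 : HarmonicAt w ζ₀ :=
    (harmonicAt_congr_nhds hu).1 (hharm.comp_CLM Complex.ofRealCLM)
  have hΔ := hharm2.2.eq_of_nhds
  rw [laplacian_eq_iteratedFDeriv_complexPlane] at hΔ
  simp only [iteratedFDeriv_two_apply, Matrix.cons_val_zero, Matrix.cons_val_one,
    Pi.zero_apply] at hΔ
  have hev : ∀ᶠ ζ in nhds ζ₀, ∀ i ∈ B, AnalyticAt ℂ (f i) ζ ∧ AnalyticAt ℂ (h i) ζ :=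
    (Filter.eventually_all_finset B).2 fun i hi =>
      (hf i hi).eventually_analyticAt.and (hh i hi).eventually_analyticAt
  have hfd : fderiv ℝ w =ᶠ[nhds ζ₀] fun ζ => ∑ i ∈ B,
      ((f i ζ * conj (deriv (h i) ζ)) • (Complex.conjCLE : ℂ →L[ℝ] ℂ) +
        (deriv (f i) ζ * conj (h i ζ)) • (1 : ℂ →L[ℝ] ℂ)) := by
    filter_upwards [hev] with ζ hζ
    exact (HasFDerivAt.fun_sum fun i hi => hasFDerivAt_mul_conj (hζ i hi).1.differentiableAt
      (hζ i hi).2.differentiableAt).fderiv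
  have hfd2 : HasFDerivAt (𝕜 := ℝ) (fun ζ => ∑ i ∈ B,
      ((f i ζ * conj (deriv (h i) ζ)) • (Complex.conjCLE : ℂ →L[ℝ] ℂ) +
        (deriv (f i) ζ * conj (h i ζ)) • (1 : ℂ →L[ℝ] ℂ))) _ ζ₀ :=
    HasFDerivAt.fun_sum (u := B) fun i hi =>
    ((hasFDerivAt_mul_conj (hf i hi).differentiableAt
      (hh i hi).deriv.differentiableAt).smul_const (Complex.conjCLE : ℂ →L[ℝ] ℂ)).add
    ((hasFDerivAt_mul_conj (hf i hi).deriv.differentiableAt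
      (hh i hi).differentiableAt).smul_const (1 : ℂ →L[ℝ] ℂ))
  rw [hfd.fderiv_eq, hfd2.fderiv, _root_.sum_apply, _root_.sum_apply,
    _root_.sum_apply, _root_.sum_apply, ← Finset.sum_add_distrib] at hΔ
  -- The factor comes from `Δ = 4 ∂∂̄`.
  have h4 : (4 : ℂ) * ∑ i ∈ B, deriv (f i) ζ₀ * conj (deriv (h i) ζ₀) = 0 := by
    rw [← hΔ, Finset.mul_sum]
    refine Finset.sum_congr rfl fun i _ => ?_
    simp
    ring_nf
    simp
    ring
  simpa using h4

end Laplacian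

/-! ### Homogeneity and common roots. -/

namespace MvPolynomial

section Scaling

variable {σ : Type*}

/-- Substitution of `2 Xᵢ` for `Xᵢ`. -/
noncomputable def double : MvPolynomial σ ℂ →ₐ[ℂ] MvPolynomial σ ℂ := aeval fun i => C 2 * X i

theorem eval_double (p : MvPolynomial σ ℂ) (z : σ → ℂ) : eval z (double p) = eval ((2 : ℂ) • z) p := by
  induction p using MvPolynomial.induction_on with
  | C a => simp [double]
  | add p q hp hq => simp [hp, hq]
  | mul_X p i hp => simp [hp]; simp [double]

theorem coeff_double (p : MvPolynomial σ ℂ) (m : σ →₀ ℕ) :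
    coeff m (double p) = 2 ^ m.degree * coeff m p := by
  classical
  induction p using MvPolynomial.induction_on' with
  | monomial u a =>
    have : double (monomial u a) = monomial u (2 ^ u.degree * a) := by
      rw [double, aeval_monomial, Finsupp.prod]
      simp_rw [mul_pow]
      rw [Finset.prod_mul_distrib, Finset.prod_pow_eq_pow_sum, monomial_eq (s := u), Finsupp.prod,
        Finsupp.degree_apply, algebraMap_eq, C_mul, C_pow]
      ring
    rw [this, coeff_monomial, coeff_monomial]
    split_ifs with h
    · rw [h]
    · simp
  | add p q hp hq => simp [hp, hq, mul_add]

/-- The numbers `2 ^ k` are distinct, so the single scalar `2` detects homogeneity; this makes it an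
algebraic identity that can be cancelled and compared. -/
theorem isHomogeneous_iff_double {p : MvPolynomial σ ℂ} {d : ℕ} :
    p.IsHomogeneous d ↔ double p = C (2 ^ d) * p := by
  constructor
  · intro h
    ext m
    rw [coeff_double, coeff_C_mul]
    by_cases hm : coeff m p = 0
    · simp [hm]
    · rw [← h hm, Finsupp.degree_eq_weight_one]
      rfl
  · intro h m hm
    have h1 := congrArg (coeff m) h
    rw [coeff_double, coeff_C_mul] at h1
    have h2 := mul_right_cancel₀ hm h1
    have h3 : m.degree = d := Nat.pow_right_injective le_rfl (by exact_mod_cast h2)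
    rw [← h3, Finsupp.degree_eq_weight_one]
    rfl

theorem IsHomogeneous.of_mul_left {p q : MvPolynomial σ ℂ} {a e : ℕ} (hp : p.IsHomogeneous e)
    (hp0 : p ≠ 0) (h : (p * q).IsHomogeneous (e + a)) : q.IsHomogeneous a := by
  rw [isHomogeneous_iff_double] at *
  rw [map_mul, hp] at h
  have h2 : C (2 ^ e) * p ≠ (0 : MvPolynomial σ ℂ) := mul_ne_zero (by simp) hp0
  refine mul_left_cancel₀ h2 (h.trans ?_)
  rw [pow_add, MvPolynomial.C_mul]
  ring

theorem IsHomogeneous.eval_smul {p : MvPolynomial σ ℂ} {d : ℕ} (hp : p.IsHomogeneous d) (t : ℂ)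
    (z : σ → ℂ) : eval (t • z) p = t ^ d * eval z p := by
  rw [eval_eq, eval_eq, Finset.mul_sum]
  refine Finset.sum_congr rfl fun m hm => ?_
  have h1 : m.degree = d := by
    rw [← hp (mem_support_iff.1 hm), Finsupp.degree_eq_weight_one]
    rfl
  simp only [Pi.smul_apply, smul_eq_mul, mul_pow]
  rw [Finset.prod_mul_distrib, Finset.prod_pow_eq_pow_sum, ← h1, Finsupp.degree_apply]
  ring

/-- Suppose that some power of each of the homogeneous polynomials under consideration is a constant
multiple of a power of `q`; then all of them are constant multiples of powers of a single one. -/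
theorem exists_common_root {q : MvPolynomial σ ℂ} {b : ℕ} (hb : 0 < b) (hq : q.IsHomogeneous b)
    (hq0 : q ≠ 0) :
    ∃ (h : MvPolynomial σ ℂ) (e : ℕ), 0 < e ∧ h.IsHomogeneous e ∧ h ≠ 0 ∧
      ∀ (a : ℕ) (f : MvPolynomial σ ℂ) (c : ℂ), f.IsHomogeneous a → c ≠ 0 →
        f ^ b = C c * q ^ a → ∃ (c' : ℂ) (m : ℕ), f = C c' * h ^ m ∧ a = e * m := by
  classical
  -- `h` is taken of least positive degree among the admissible polynomials, `q` itself being one.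
  -- Any other admissible `f` is then divisible by `h`, and the quotient is again admissible, of
  -- smaller degree.
  have hex : ∃ a, 0 < a ∧ ∃ (f : MvPolynomial σ ℂ) (c : ℂ), f.IsHomogeneous a ∧ c ≠ 0 ∧
      f ^ b = C c * q ^ a := ⟨b, hb, q, 1, hq, one_ne_zero, by simp⟩
  obtain ⟨he, h, c₀, hh, hc₀, hpow⟩ := Nat.find_spec hex
  set e := Nat.find hex with he_def
  have hmin : ∀ a, 0 < a → ∀ (f : MvPolynomial σ ℂ) (c : ℂ), f.IsHomogeneous a → c ≠ 0 →
      f ^ b = C c * q ^ a → e ≤ a := fun a ha f c hf hc hfa =>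
    Nat.find_min' hex ⟨ha, f, c, hf, hc, hfa⟩
  have hh0 : h ≠ 0 := by
    rintro rfl
    rw [zero_pow hb.ne'] at hpow
    exact mul_ne_zero (by simpa using hc₀) (pow_ne_zero _ hq0) hpow.symm
  refine ⟨h, e, he, hh, hh0, fun a => ?_⟩
  induction a using Nat.strong_induction_on with
  | _ a ih =>
    intro f c hf hc hfa
    rcases Nat.eq_zero_or_pos a with rfl | ha
    · rw [← totalDegree_zero_iff_isHomogeneous, totalDegree_eq_zero_iff_eq_C] at hf
      exact ⟨coeff 0 f, 0, by simpa using hf, by simp⟩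
    · obtain ⟨k, rfl⟩ := Nat.exists_eq_add_of_le (hmin a ha f c hf hc hfa)
      have hdvd : h ^ b ∣ f ^ b := by
        refine ⟨C (c * c₀⁻¹) * q ^ k, ?_⟩
        rw [hfa, hpow, C_mul, pow_add]
        have : C c₀ * C c₀⁻¹ = (1 : MvPolynomial σ ℂ) := by rw [← C_mul, mul_inv_cancel₀ hc₀, C_1]
        linear_combination (-(C c * q ^ e * q ^ k)) * this
      -- Unique factorization: `h ^ b ∣ f ^ b` forces `h ∣ f`.
      obtain ⟨g, rfl⟩ := (UniqueFactorizationMonoid.pow_dvd_pow_iff_dvd hb.ne').1 hdvd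
      have hg : g.IsHomogeneous k := hh.of_mul_left hh0 hf
      have hgk : g ^ b = C (c * c₀⁻¹) * q ^ k := by
        refine mul_left_cancel₀ (pow_ne_zero b hh0) ?_
        rw [← mul_pow, hfa, hpow, C_mul, pow_add]
        have : C c₀ * C c₀⁻¹ = (1 : MvPolynomial σ ℂ) := by rw [← C_mul, mul_inv_cancel₀ hc₀, C_1]
        linear_combination (-(C c * q ^ e * q ^ k)) * this
      obtain ⟨c', m, hgm, hkm⟩ := ih k (by omega) g _ hg
        (mul_ne_zero hc (inv_ne_zero hc₀)) hgk
      refine ⟨c', m + 1, ?_, ?_⟩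
      · rw [hgm, pow_succ]
        ring
      · rw [hkm]
        ring

end Scaling

/-! ### Directional derivatives and proportional gradients. -/

section DirectionalDerivatives

variable {σ : Type*} [Fintype σ]

/-- The derivative of `q` at `z` in direction `v`. -/
noncomputable def dirDeriv (q : MvPolynomial (σ) ℂ) (z v : σ → ℂ) : ℂ :=
  ∑ j, v j * eval z (pderiv j q)

theorem hasDerivAt_eval (q : MvPolynomial (σ) ℂ) {φ : ℂ → σ → ℂ} {v : σ → ℂ} {ζ : ℂ}
    (hφ : HasDerivAt φ v ζ) :
    HasDerivAt (fun x => eval (φ x) q) (dirDeriv q (φ ζ) v) ζ := by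
  classical
  induction q using MvPolynomial.induction_on with
  | C a => simpa [dirDeriv] using hasDerivAt_const ζ a
  | add p q hp hq =>
    simp only [map_add]
    refine (hp.add hq).congr_deriv ?_
    simp [dirDeriv, mul_add, Finset.sum_add_distrib]
  | mul_X p i hp =>
    simp only [map_mul, eval_X]
    refine (hp.mul (hasDerivAt_pi.1 hφ i)).congr_deriv ?_
    simp [dirDeriv, Derivation.leibniz, mul_add, Finset.sum_add_distrib, pderiv_X, Pi.single_apply,
      Finset.sum_mul, apply_ite]
    rw [add_comm, mul_comm (v i)]
    exact congrArg _ (Finset.sum_congr rfl fun _ _ => by ring)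

theorem dirDeriv_add_right (q : MvPolynomial (σ) ℂ) (z v w : σ → ℂ) :
    dirDeriv q z (v + w) = dirDeriv q z v + dirDeriv q z w := by
  simp [dirDeriv, add_mul, Finset.sum_add_distrib]

theorem dirDeriv_smul_right (q : MvPolynomial (σ) ℂ) (z v : σ → ℂ) (t : ℂ) :
    dirDeriv q z (t • v) = t * dirDeriv q z v := by
  simp [dirDeriv, mul_assoc, Finset.mul_sum]

theorem hasDerivAt_line (z w : σ → ℂ) (ζ : ℂ) : HasDerivAt (fun x : ℂ => z + x • w) w ζ := by
  simpa using ((hasDerivAt_id ζ).smul_const w).const_add z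

/-- The restriction of `q` to the complex line `ζ ↦ z + ζ w`. -/
noncomputable def lineRestrict (q : MvPolynomial (σ) ℂ) (z w : σ → ℂ) : Polynomial ℂ :=
  aeval (fun i => Polynomial.C (z i) + Polynomial.X * Polynomial.C (w i)) q

omit [Fintype σ] in
theorem eval_lineRestrict (q : MvPolynomial (σ) ℂ) (z w : σ → ℂ) (ζ : ℂ) :
    (lineRestrict q z w).eval ζ = eval (z + ζ • w) q := by
  induction q using MvPolynomial.induction_on with
  | C a => simp [lineRestrict]
  | add p q hp hq => simp_all [lineRestrict]
  | mul_X p i hp =>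
    simp_all [lineRestrict]
    exact Or.inl (mul_comm _ _)

theorem eval_derivative_lineRestrict (q : MvPolynomial (σ) ℂ) (z w : σ → ℂ) (ζ : ℂ) :
    (Polynomial.derivative (lineRestrict q z w)).eval ζ = dirDeriv q (z + ζ • w) w := by
  have h1 := (lineRestrict q z w).hasDerivAt ζ
  simp_rw [eval_lineRestrict] at h1
  exact h1.unique (hasDerivAt_eval q (hasDerivAt_line z w ζ))

theorem coeff_one_lineRestrict (q : MvPolynomial (σ) ℂ) (z w : σ → ℂ) :
    (lineRestrict q z w).coeff 1 = dirDeriv q z w := by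
  have := eval_derivative_lineRestrict q z w 0
  rw [← Polynomial.coeff_zero_eq_eval_zero, Polynomial.coeff_derivative] at this
  simpa using this

theorem differentiable_eval_line (q : MvPolynomial (σ) ℂ) (z w : σ → ℂ) :
    Differentiable ℂ fun ζ : ℂ => eval (z + ζ • w) q := fun ζ =>
  (hasDerivAt_eval q (hasDerivAt_line z w ζ)).differentiableAt

theorem eq_of_eval_eq_on_open {p q : MvPolynomial (σ) ℂ} {U : Set (σ → ℂ)} (hU : IsOpen U)
    (hne : U.Nonempty) (h : ∀ z ∈ U, eval z p = eval z q) : p = q := by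
  obtain ⟨z, hz⟩ := hne
  obtain ⟨ε, hε, hball⟩ := Metric.isOpen_iff.1 hU z hz
  refine funext_set (fun i => Metric.ball (z i) ε) (fun i => ?_) fun x hx => h x (hball ?_)
  · exact infinite_of_mem_nhds (z i) (Metric.ball_mem_nhds _ hε)
  · rw [← ball_pi _ hε] at hx
    exact hx

/-- Two polynomials with the same logarithmic derivative are proportional. -/
theorem exists_eq_C_mul_of_pderiv {F K : MvPolynomial (σ) ℂ} (hK : K ≠ 0)
    (h : ∀ l, pderiv l F * K = F * pderiv l K) : ∃ c, F = C c * K := by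
  obtain ⟨z₀, hz₀⟩ : ∃ z, eval z K ≠ 0 := by
    by_contra! hne
    exact hK (MvPolynomial.funext fun z => by simpa using hne z)
  set c := eval z₀ F / eval z₀ K with hc
  refine ⟨c, ?_⟩
  rw [← sub_eq_zero]
  -- `E` satisfies the same equation as `F` and vanishes at `z₀`, where `K` does not; the goal
  -- becomes `E = 0`, checked on each line through `z₀`.
  set E := F - C c * K with hE
  have hEK : ∀ l, pderiv l E * K = E * pderiv l K := fun l => by
    simp only [hE, map_sub, pderiv_C_mul]
    linear_combination h l
  have hE0 : eval z₀ E = 0 := by simp [hE, hc, hz₀]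
  refine MvPolynomial.funext fun z => ?_
  set e := lineRestrict E z₀ (z - z₀)
  set k := lineRestrict K z₀ (z - z₀)
  have hk0 : k.eval 0 ≠ 0 := by simpa [k, eval_lineRestrict] using hz₀
  have he0 : e.IsRoot 0 := by simpa [e, eval_lineRestrict] using hE0
  have hek : Polynomial.derivative e * k = e * Polynomial.derivative k := by
    refine Polynomial.funext fun ζ => ?_
    simp only [Polynomial.eval_mul, e, k, eval_derivative_lineRestrict, eval_lineRestrict, dirDeriv,
      Finset.sum_mul, Finset.mul_sum]
    refine Finset.sum_congr rfl fun l _ => ?_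
    have := congrArg (eval (z₀ + ζ • (z - z₀))) (hEK l)
    simp only [map_mul] at this
    linear_combination ((z - z₀) l) * this
  have he : e = 0 := by
    by_contra hne
    have hd : Polynomial.derivative e ≠ 0 := by
      intro hd
      have := Polynomial.eq_C_of_derivative_eq_zero hd
      apply hne
      rw [this, Polynomial.coeff_zero_eq_eval_zero, he0.eq_zero, map_zero]
    have hk : k ≠ 0 := by
      rintro hk
      simp [hk] at hk0
    have hdk := mul_ne_zero hd hk
    -- In `e' k = e k'` with `k(0) ≠ 0`, the left side vanishes at `0` to one order less than `e`,
    -- the right side at least to the order of `e`.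
    have hm := congrArg (Polynomial.rootMultiplicity 0) hek
    rw [Polynomial.rootMultiplicity_mul hdk, Polynomial.rootMultiplicity_mul (hek ▸ hdk),
      Polynomial.derivative_rootMultiplicity_of_root he0,
      Polynomial.rootMultiplicity_eq_zero (p := k) hk0] at hm
    have := (Polynomial.rootMultiplicity_pos hne).2 he0
    omega
  have := eval_lineRestrict E z₀ (z - z₀) 1
  simpa [show lineRestrict E z₀ (z - z₀) = 0 from he] using this.symm

/-- Homogeneous polynomials with everywhere proportional gradients are algebraically dependent. -/
theorem IsHomogeneous.exists_pow_eq_C_mul_pow {f g : MvPolynomial (σ) ℂ} {a b : ℕ}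
    (hf : f.IsHomogeneous a) (hg : g.IsHomogeneous b) (ha : 0 < a) (hb : 0 < b) (hf0 : f ≠ 0)
    (hg0 : g ≠ 0) (h : ∀ j l, pderiv j f * pderiv l g = pderiv l f * pderiv j g) :
    ∃ c : ℂ, c ≠ 0 ∧ f ^ b = C c * g ^ a := by
  -- Contracting the hypothesis with `X j` and using Euler's identity shows that `f ^ b` and `g ^ a`
  -- have equal logarithmic derivatives.
  have h1 : ∀ l, (a : MvPolynomial (σ) ℂ) * f * pderiv l g = b * g * pderiv l f := by
    intro l
    have hf1 := hf.sum_X_mul_pderiv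
    have hg1 := hg.sum_X_mul_pderiv
    rw [nsmul_eq_mul] at hf1 hg1
    rw [← hf1, ← hg1, Finset.sum_mul, Finset.sum_mul]
    refine Finset.sum_congr rfl fun j _ => ?_
    linear_combination X j * h j l
  obtain ⟨c, hc⟩ := exists_eq_C_mul_of_pderiv (F := f ^ b) (K := g ^ a) (pow_ne_zero _ hg0)
    fun l => by
      obtain ⟨a, rfl⟩ : ∃ k, a = k + 1 := ⟨a - 1, by omega⟩
      obtain ⟨b, rfl⟩ : ∃ k, b = k + 1 := ⟨b - 1, by omega⟩
      simp only [pderiv_pow, add_tsub_cancel_right]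
      linear_combination (-(f ^ b * g ^ a)) * h1 l
  refine ⟨c, ?_, hc⟩
  rintro rfl
  simp [hf0] at hc

end DirectionalDerivatives

end MvPolynomial

/-! ### Polarization of polynomials in `z, conj z`. -/

namespace MvPolynomial

section Polarization

variable {n : ℕ}

/-- A polynomial in `z, conj z` is determined by its values. -/
theorem eq_of_evalConj_eq {p p' : MvPolynomial (Fin n ⊕ Fin n) ℂ}
    (h : ∀ z, evalConj p z = evalConj p' z) : p = p' := by
  have h1 := eq_zero_of_vanish_on_antidiagonal
    (F := fun z η => eval (Sum.elim z η) p - eval (Sum.elim z η) p') (fun z η a b => ?_)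
    isOpen_univ Set.univ_nonempty (fun z _ => sub_eq_zero.2 (h z))
  · refine MvPolynomial.funext fun x => ?_
    have h2 := sub_eq_zero.1 (h1 (x ∘ Sum.inl) (x ∘ Sum.inr))
    rwa [Sum.elim_comp_inl_inr] at h2
  · have h3 : ∀ s : ℂ, (Sum.elim (z + s • a) (η + s • b) : Fin n ⊕ Fin n → ℂ) =
        Sum.elim z η + s • Sum.elim a b := fun s => by
      ext (i | i) <;> simp
    simp_rw [h3]
    exact (differentiable_eval_line _ _ _).sub (differentiable_eval_line _ _ _)

theorem isHomogeneous_of_isRealHomogeneous {P : (Fin n → ℂ) → ℝ}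
    {p : MvPolynomial (Fin n ⊕ Fin n) ℂ} (hp : ∀ z, (P z : ℂ) = evalConj p z) {d : ℕ}
    (hd : ∀ (t : ℝ) (z : Fin n → ℂ), P ((t : ℂ) • z) = t ^ d * P z) : p.IsHomogeneous d := by
  rw [isHomogeneous_iff_double]
  refine eq_of_evalConj_eq fun z => ?_
  have h1 : evalConj (double p) z = evalConj p ((2 : ℂ) • z) := by
    rw [evalConj, eval_double, evalConj]
    congr 2
    ext (i | i) <;> simp [map_ofNat]
  have h2 := hd 2 z
  rw [h1, ← hp, evalConj, map_mul, eval_C, ← evalConj, ← hp]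
  rw [Complex.ofReal_ofNat] at h2
  rw [h2]
  push_cast
  ring

theorem eval_conj_monomial (β : Fin n →₀ ℕ) (z : Fin n → ℂ) :
    eval (fun i => conj (z i)) (monomial β 1) = conj (eval z (monomial β 1)) := by
  simp [eval_monomial, Finsupp.prod]

theorem eval_conj_pderiv_monomial (β : Fin n →₀ ℕ) (k : Fin n) (z : Fin n → ℂ) :
    eval (fun i => conj (z i)) (pderiv k (monomial β 1)) =
      conj (eval z (pderiv k (monomial β 1))) := by
  simp [pderiv_monomial, eval_monomial, Finsupp.prod]

/-- The value at `(z, η)` of the polarization `∑ q β (z) η ^ β`. -/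
noncomputable def polar (B : Finset (Fin n →₀ ℕ)) (q : (Fin n →₀ ℕ) → MvPolynomial (Fin n) ℂ)
    (z η : Fin n → ℂ) : ℂ :=
  ∑ β ∈ B, eval z (q β) * eval η (monomial β 1)

/-- Monomials are grouped by their exponent `β` in `conj z`. The absence of pluriharmonic terms
becomes `0 < β.degree < d`, and exponents with `q β = 0` are dropped. -/
theorem exists_eq_polar {p : MvPolynomial (Fin n ⊕ Fin n) ℂ} {d : ℕ} (hp : p.IsHomogeneous d)
    (hterms : ∀ m ∈ p.support, (∃ i, m (Sum.inl i) ≠ 0) ∧ (∃ j, m (Sum.inr j) ≠ 0)) :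
    ∃ (B : Finset (Fin n →₀ ℕ)) (q : (Fin n →₀ ℕ) → MvPolynomial (Fin n) ℂ),
      (∀ z η, eval (Sum.elim z η) p = polar B q z η) ∧
      ∀ β ∈ B, 0 < β.degree ∧ β.degree < d ∧ (q β).IsHomogeneous (d - β.degree) ∧ q β ≠ 0 := by
  classical
  set lft : (Fin n ⊕ Fin n →₀ ℕ) → (Fin n →₀ ℕ) := fun m => (Finsupp.sumFinsuppEquivProdFinsupp m).1
  set rgt : (Fin n ⊕ Fin n →₀ ℕ) → (Fin n →₀ ℕ) := fun m => (Finsupp.sumFinsuppEquivProdFinsupp m).2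
  have hdeg : ∀ m ∈ p.support, (lft m).degree + (rgt m).degree = d := by
    intro m hm
    have h1 : m.degree = d := by
      rw [← hp (mem_support_iff.1 hm), Finsupp.degree_eq_weight_one]
      rfl
    rw [← h1, Finsupp.degree_eq_sum, Finsupp.degree_eq_sum, Finsupp.degree_eq_sum,
      Fintype.sum_sum_type]
    rfl
  set q : (Fin n →₀ ℕ) → MvPolynomial (Fin n) ℂ := fun β =>
    ∑ m ∈ p.support with rgt m = β, monomial (lft m) (coeff m p)
  have hpos : ∀ (x : Fin n →₀ ℕ) (i : Fin n), x i ≠ 0 → 0 < x.degree := fun x i hi =>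
    Nat.pos_of_ne_zero fun h => hi (by rw [(Finsupp.degree_eq_zero_iff x).1 h]; rfl)
  refine ⟨(p.support.image rgt).filter (fun β => q β ≠ 0), q, fun z η => ?_, fun β hβ => ?_⟩
  · have hfilter : ∀ β ∈ p.support.image rgt,
        eval z (q β) * eval η (monomial β 1) ≠ 0 → q β ≠ 0 := fun β _ h hq =>
      h (by rw [hq, map_zero, zero_mul])
    rw [polar, Finset.sum_filter_of_ne hfilter, eval_eq',
      ← Finset.sum_fiberwise_of_maps_to (g := rgt) (t := p.support.image rgt)
        (fun m hm => Finset.mem_image_of_mem _ hm)]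
    refine Finset.sum_congr rfl fun β _ => ?_
    rw [map_sum, Finset.sum_mul]
    refine Finset.sum_congr rfl fun m hm => ?_
    rw [← (Finset.mem_filter.1 hm).2, eval_monomial, eval_monomial, Fintype.prod_sum_type,
      Finsupp.prod_fintype _ _ (by simp), Finsupp.prod_fintype _ _ (by simp), one_mul, mul_assoc]
    rfl
  · obtain ⟨hβ1, hβ2⟩ := Finset.mem_filter.1 hβ
    obtain ⟨m, hm, rfl⟩ := Finset.mem_image.1 hβ1
    obtain ⟨⟨i, hi⟩, ⟨j, hj⟩⟩ := hterms m hm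
    have h1 := hpos (lft m) i hi
    have h2 := hpos (rgt m) j hj
    have h3 := hdeg m hm
    refine ⟨h2, by omega, IsHomogeneous.sum _ _ _ fun m' hm' => ?_, hβ2⟩
    obtain ⟨hm1, hm2⟩ := Finset.mem_filter.1 hm'
    refine isHomogeneous_monomial _ ?_
    have := hdeg m' hm1
    rw [hm2] at this
    omega

end Polarization

/-! ### The Levi form and its kernel. -/

section Levi

variable {n : ℕ} (B : Finset (Fin n →₀ ℕ)) (q : (Fin n →₀ ℕ) → MvPolynomial (Fin n) ℂ)

/-- The Levi form of `∑ q β (z) conj (z ^ β)`. -/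
noncomputable def levi (z v w : Fin n → ℂ) : ℂ :=
  ∑ β ∈ B, dirDeriv (q β) z v * conj (dirDeriv (monomial β 1) z w)

variable {B q}

theorem levi_add_smul (z v w : Fin n → ℂ) (t : ℂ) :
    levi B q z (w + t • v) (w + t • v) = levi B q z w w + t * levi B q z v w +
      conj t * levi B q z w v + t * conj t * levi B q z v v := by
  simp only [levi, dirDeriv_add_right, dirDeriv_smul_right, map_add, map_mul, Finset.mul_sum,
    ← Finset.sum_add_distrib]
  exact Finset.sum_congr rfl fun _ _ => by ring

/-- A null vector of a positive semidefinite Levi form lies in its kernel. -/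
theorem levi_eq_zero_of_nonneg {z v : Fin n → ℂ}
    (hpos : ∀ w, 0 ≤ (levi B q z w w).re ∧ (levi B q z w w).im = 0)
    (hv : levi B q z v v = 0) (w : Fin n → ℂ) : levi B q z v w = 0 := by
  set a := levi B q z v w with ha
  set b := levi B q z w v with hb
  -- Since `levi v v = 0`, positivity at `w + t v` is affine in `t` and `conj t`. The values `t = 1,
  -- i` give `b = conj a`, and `t = -s conj a` with `s` large forces `a = 0`.
  have key : ∀ t : ℂ, 0 ≤ (levi B q z w w + t * a + conj t * b).re ∧
      (t * a + conj t * b).im = 0 := by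
    intro t
    have h1 := hpos (w + t • v)
    rw [levi_add_smul, hv, mul_zero, add_zero] at h1
    refine ⟨h1.1, ?_⟩
    have h2 := h1.2
    rw [add_assoc, Complex.add_im, (hpos w).2, zero_add] at h2
    exact h2
  have k1 := (key 1).2
  have k2 := (key Complex.I).2
  simp at k1 k2
  have hre : b.re = a.re := by linarith
  have him : b.im = -a.im := by linarith
  set L := (levi B q z w w).re with hL
  set N := a.re ^ 2 + a.im ^ 2 with hN
  have k3 : ∀ s : ℝ, 0 ≤ L - 2 * s * N := fun s => by
    have := (key (-(s : ℂ) * conj a)).1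
    simp [hre, him, ← hL] at this
    linarith
  have hN0 : N = 0 := by
    by_contra hne
    have := k3 ((L + 1) / (2 * N))
    field_simp at this
    linarith
  apply Complex.ext <;> simp only [Complex.zero_re, Complex.zero_im] <;> nlinarith

variable {P : (Fin n → ℂ) → ℝ} (hP : ∀ z, (P z : ℂ) = polar B q z fun i => conj (z i))
include hP

theorem ofReal_eq_sum_eval_mul_conj (z : Fin n → ℂ) :
    (P z : ℂ) = ∑ β ∈ B, eval z (q β) * conj (eval z (monomial β 1)) := by
  simp_rw [hP, polar, eval_conj_monomial]

/-- The Levi form on `(w, w)` is the coefficient of `ζ * conj ζ` in `P (z + ζ w)`. -/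
theorem levi_nonneg_of_isPlurisubharmonic (hpsh : IsPlurisubharmonic P) (z w : Fin n → ℂ) :
    0 ≤ (levi B q z w w).re ∧ (levi B q z w w).im = 0 := by
  have h1 := mixed_coeff_nonneg_of_subMean (B := B) (F := fun β => lineRestrict (q β) z w)
    (H := fun β => lineRestrict (monomial β 1) z w) (u := fun ζ => P (z + ζ • w))
    (fun ζ => by simp_rw [eval_lineRestrict]; exact ofReal_eq_sum_eval_mul_conj hP _)
    (fun r hr => ((hpsh.2 z w).2 0 r hr).2)
  simp only [coeff_one_lineRestrict] at h1
  exact h1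

/-- Along a curve in the level set with tangent `v`, the Laplacian of `P` is four times the Levi
form on `(v, v)`. -/
theorem levi_eq_zero_of_mem_ker {G : (Fin n → ℂ) → ℂ} (hG : Differentiable ℂ G)
    {U : Set (Fin n → ℂ)} (hU : IsOpen U)
    (hharm : ∀ c : ℂ, IsPluriharmonicAlong P {z | z ∈ U ∧ G z = c})
    {z v : Fin n → ℂ} (hz : z ∈ U) (hGz : fderiv ℂ G z ≠ 0) (hv : fderiv ℂ G z v = 0) :
    levi B q z v v = 0 := by
  obtain ⟨V, φ, hV, h0, hφ, hmaps, hφ0, hφd⟩ := hG.exists_curve_in_level_set hGz hv hU hz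
  have h1 := hharm (G z) V φ hV hφ (fun ζ hζ => hmaps ζ hζ) 0 h0
  have han : ∀ f : MvPolynomial (Fin n) ℂ, AnalyticAt ℂ (fun ζ => eval (φ ζ) f) 0 := by
    intro f
    refine DifferentiableOn.analyticAt (s := V) (fun ζ hζ => ?_) (hV.mem_nhds h0)
    have := ((hφ ζ hζ).differentiableAt (hV.mem_nhds hζ)).hasDerivAt
    exact (hasDerivAt_eval f this).differentiableAt.differentiableWithinAt
  have h2 := sum_deriv_mul_conj_deriv_eq_zero_of_harmonicAt (B := B)
    (f := fun β ζ => eval (φ ζ) (q β)) (h := fun β ζ => eval (φ ζ) (monomial β 1))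
    (fun β _ => han _) (fun β _ => han _)
    (Filter.Eventually.of_forall fun ζ => ofReal_eq_sum_eval_mul_conj hP _) h1
  simpa only [(hasDerivAt_eval _ hφd).deriv, hφ0, levi] using h2

/-- If `P` is pluriharmonic along the level sets of `G`, the gradients of the coefficients of the
polarization of `P` are proportional to the gradient of `G`. -/
theorem fderiv_mul_pderiv_eq (hpsh : IsPlurisubharmonic P) (hB : ∀ β ∈ B, 0 < β.degree)
    {G : (Fin n → ℂ) → ℂ} (hG : Differentiable ℂ G)
    {U : Set (Fin n → ℂ)} (hU : IsOpen U) (hne : U.Nonempty) (hGz : ∀ z ∈ U, fderiv ℂ G z ≠ 0)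
    (hharm : ∀ c : ℂ, IsPluriharmonicAlong P {z | z ∈ U ∧ G z = c}) (j l : Fin n)
    (z : Fin n → ℂ) {β : Fin n →₀ ℕ} (hβ : β ∈ B) :
    fderiv ℂ G z (Pi.single l 1) * eval z (pderiv j (q β)) =
      fderiv ℂ G z (Pi.single j 1) * eval z (pderiv l (q β)) := by
  classical
  set A : (Fin n →₀ ℕ) → (Fin n → ℂ) → ℂ := fun β z =>
    fderiv ℂ G z (Pi.single l 1) * eval z (pderiv j (q β)) -
      fderiv ℂ G z (Pi.single j 1) * eval z (pderiv l (q β)) with hA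
  have h1 : ∀ k z η, ∑ β ∈ B, A β z * eval η (pderiv k (monomial β 1)) = 0 := by
    intro k
    refine eq_zero_of_vanish_on_antidiagonal (fun z η a b => ?_) hU hne (fun z hz => ?_)
    · refine Differentiable.fun_sum fun β _ => Differentiable.mul ?_ (differentiable_eval_line _ _ _)
      exact ((hG.differentiable_fderiv_line _ _ _).mul (differentiable_eval_line _ _ _)).sub
        ((hG.differentiable_fderiv_line _ _ _).mul (differentiable_eval_line _ _ _))
    · set v : Fin n → ℂ := fderiv ℂ G z (Pi.single l 1) • Pi.single j 1 -
        fderiv ℂ G z (Pi.single j 1) • Pi.single l 1 with hv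
      have hker : fderiv ℂ G z v = 0 := by
        rw [hv, map_sub, map_smul, map_smul, smul_eq_mul, smul_eq_mul]
        ring
      have h2 := levi_eq_zero_of_nonneg (levi_nonneg_of_isPlurisubharmonic hP hpsh z)
        (levi_eq_zero_of_mem_ker hP hG hU hharm hz (hGz z hz) hker) (Pi.single k 1)
      rw [← h2, levi]
      refine Finset.sum_congr rfl fun β _ => ?_
      rw [eval_conj_pderiv_monomial]
      have hs : ∀ (f : MvPolynomial (Fin n) ℂ) (i : Fin n),
          dirDeriv f z (Pi.single i 1) = eval z (pderiv i f) := fun f i => by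
        simp [dirDeriv, Pi.single_apply]
      have hsub : dirDeriv (q β) z v = A β z := by
        rw [hv, sub_eq_add_neg, ← neg_smul, dirDeriv_add_right, dirDeriv_smul_right,
          dirDeriv_smul_right, hs, hs]
        ring
      rw [hs, hsub]
  -- With `z` fixed, `R` is a polynomial in `η` with zero gradient, hence constant; as no `β ∈ B` is
  -- `0`, every `A β z` vanishes.
  set R : MvPolynomial (Fin n) ℂ := ∑ β ∈ B, C (A β z) * monomial β 1 with hR
  have hRd : ∀ k, pderiv k R = 0 := fun k => MvPolynomial.funext fun η => by
    rw [hR, map_sum, map_sum, map_zero, ← h1 k z η]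
    exact Finset.sum_congr rfl fun β _ => by rw [pderiv_C_mul, map_mul, eval_C]
  obtain ⟨c, hc⟩ := exists_eq_C_mul_of_pderiv (F := R) one_ne_zero fun k => by simp [hRd]
  have hcoef := congrArg (coeff β) hc
  have hβ0 : (0 : Fin n →₀ ℕ) ≠ β := by
    rintro rfl
    simpa using hB _ hβ
  rw [hR, coeff_sum, mul_one, coeff_C, if_neg hβ0] at hcoef
  simp only [coeff_C_mul, coeff_monomial, mul_ite, mul_one, mul_zero, Finset.sum_ite_eq', hβ,
    if_true] at hcoef
  exact sub_eq_zero.1 hcoef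

end Levi

end MvPolynomial

/-! ### Subharmonicity of the one-variable factor. -/

/-- A real polynomial in `w, conj w` is subharmonic if its pullback under `ζ ↦ ζ ^ e` has the local
sub-mean value property. -/
theorem isSubharmonic_of_subMean_comp_pow {ι : Type*} {B : Finset ι} {f g : ι → Polynomial ℂ}
    {s : ℂ → ℝ} (hs : ∀ w, (s w : ℂ) = ∑ i ∈ B, (f i).eval w * conj ((g i).eval w)) {e : ℕ}
    (he : 0 < e)
    (hsub : ∀ (ζ : ℂ) (r : ℝ), 0 < r →
      s (ζ ^ e) ≤ Real.circleAverage (fun v => s ((ζ + v) ^ e)) 0 r) :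
    IsSubharmonic s := by
  have hcont : Continuous s := continuous_of_ofReal_eq_sum hs
  set Λ : ℂ → ℂ := fun w => ∑ i ∈ B,
    (Polynomial.derivative (f i)).eval w * conj ((Polynomial.derivative (g i)).eval w) with hΛ
  have hΛc : Continuous Λ := continuous_sum_eval_mul_conj B _ _
  have hpos0 : ∀ w, w ≠ 0 → 0 ≤ (Λ w).re := by
    intro w hw
    obtain ⟨ζ, rfl⟩ := IsAlgClosed.exists_pow_nat_eq w he
    have h1 := (mixed_coeff_nonneg_of_subMean (B := B) (u := fun v => s ((ζ + v) ^ e))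
      (F := fun i => (f i).comp ((Polynomial.C ζ + Polynomial.X) ^ e))
      (H := fun i => (g i).comp ((Polynomial.C ζ + Polynomial.X) ^ e))
      (fun v => by simp [hs]) (fun r hr => by simpa using hsub ζ r hr)).1
    have h2 : ∀ f : Polynomial ℂ, (f.comp ((Polynomial.C ζ + Polynomial.X) ^ e)).coeff 1 =
        e * ζ ^ (e - 1) * (Polynomial.derivative f).eval (ζ ^ e) := by
      intro f
      have : (f.comp ((Polynomial.C ζ + Polynomial.X) ^ e)).coeff 1 =
          (Polynomial.derivative (f.comp ((Polynomial.C ζ + Polynomial.X) ^ e))).eval 0 := by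
        rw [← Polynomial.coeff_zero_eq_eval_zero, Polynomial.coeff_derivative]
        simp
      rw [this, Polynomial.derivative_comp]
      simp [Polynomial.derivative_pow]
    -- Chain rule: pulling back by `ζ ^ e` multiplies `Λ` by `|e ζ ^ (e - 1)| ^ 2`, positive away
    -- from `0`. The point `0` is recovered by continuity.
    have h3 : ∑ i ∈ B, ((f i).comp ((Polynomial.C ζ + Polynomial.X) ^ e)).coeff 1 *
        conj (((g i).comp ((Polynomial.C ζ + Polynomial.X) ^ e)).coeff 1) =
        ((Complex.normSq (e * ζ ^ (e - 1)) : ℝ) : ℂ) * Λ (ζ ^ e) := by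
      rw [hΛ, Finset.mul_sum, ← Complex.mul_conj]
      refine Finset.sum_congr rfl fun i _ => ?_
      rw [h2, h2, map_mul]
      ring
    rw [h3, Complex.re_ofReal_mul] at h1
    refine nonneg_of_mul_nonneg_right h1 (Complex.normSq_pos.2 (mul_ne_zero ?_ (pow_ne_zero _ ?_)))
    · exact_mod_cast he.ne'
    · rintro rfl
      exact hw (zero_pow he.ne')
  have hpos : ∀ w, 0 ≤ (Λ w).re := by
    have hcl : IsClosed {w | 0 ≤ (Λ w).re} :=
      isClosed_le continuous_const (Complex.continuous_re.comp hΛc)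
    have h1 := hcl.closure_subset_iff.2 (fun w (hw : w ∈ ({0}ᶜ : Set ℂ)) => hpos0 w hw)
    rw [(dense_compl_singleton (0 : ℂ)).closure_eq] at h1
    exact fun w => h1 (Set.mem_univ w)
  refine ⟨hcont.upperSemicontinuous, fun c r _ => ⟨hcont.continuousOn.circleIntegrable', ?_⟩⟩
  have h1 := subMean_of_laplacian_nonneg (B := B) (u := fun v => s (v + c))
    (F := fun i => (f i).comp (Polynomial.X + Polynomial.C c))
    (H := fun i => (g i).comp (Polynomial.X + Polynomial.C c)) (fun v => by simp [hs])
    (fun v => by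
      have h2 := hpos (v + c)
      simp only [hΛ] at h2
      simpa [Polynomial.derivative_comp] using h2) r
  rw [Real.circleAverage_map_add_const] at h1
  simpa using h1

/-! ### Hermitian symmetry and factorization through `h`. -/

namespace MvPolynomial

variable {n : ℕ} {B : Finset (Fin n →₀ ℕ)} {q : (Fin n →₀ ℕ) → MvPolynomial (Fin n) ℂ}
  {P : (Fin n → ℂ) → ℝ}

theorem eval_map_conj (f : MvPolynomial (Fin n) ℂ) (z : Fin n → ℂ) :
    eval (fun i => conj (z i)) (map (starRingEnd ℂ) f) = conj (eval z f) := by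
  induction f using MvPolynomial.induction_on with
  | C a => simp
  | add p q hp hq => simp [hp, hq]
  | mul_X p i hp => simp [hp]

/-- Reality of `P` makes both sides agree on `η = conj z`, hence everywhere. The dependence on `η`
thus also passes through the `q β` alone. -/
theorem polar_eq_of_real (hP : ∀ z, (P z : ℂ) = polar B q z fun i => conj (z i))
    (z η : Fin n → ℂ) :
    polar B q z η = ∑ β ∈ B, eval η (map (starRingEnd ℂ) (q β)) * eval z (monomial β 1) := by
  refine sub_eq_zero.1 (eq_zero_of_vanish_on_antidiagonal (F := fun z η => polar B q z η -
    ∑ β ∈ B, eval η (map (starRingEnd ℂ) (q β)) * eval z (monomial β 1))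
    (fun z η a b => ?_) isOpen_univ Set.univ_nonempty (fun z _ => sub_eq_zero.2 ?_) z η)
  · exact (Differentiable.fun_sum fun β _ =>
      (differentiable_eval_line _ _ _).mul (differentiable_eval_line _ _ _)).sub
      (Differentiable.fun_sum fun β _ =>
      (differentiable_eval_line _ _ _).mul (differentiable_eval_line _ _ _))
  · have h1 := congrArg conj (ofReal_eq_sum_eval_mul_conj hP z)
    rw [Complex.conj_ofReal, hP, map_sum] at h1
    rw [h1]
    refine Finset.sum_congr rfl fun β _ => ?_
    rw [eval_map_conj, map_mul, Complex.conj_conj]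

/-- If the coefficients of the polarization of `P` agree at `z` and `z'`, so do the values of `P`. -/
theorem eq_of_forall_eval_eq (hP : ∀ z, (P z : ℂ) = polar B q z fun i => conj (z i))
    {z z' : Fin n → ℂ} (h : ∀ β ∈ B, eval z (q β) = eval z' (q β)) : P z = P z' := by
  apply Complex.ofReal_injective
  rw [hP z, hP z', polar_eq_of_real hP z']
  have h1 : polar B q z (fun i => conj (z i)) = polar B q z' (fun i => conj (z i)) :=
    Finset.sum_congr rfl fun β hβ => by rw [h β hβ]
  rw [h1, polar_eq_of_real hP z']
  refine Finset.sum_congr rfl fun β hβ => ?_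
  rw [eval_map_conj, eval_map_conj, h β hβ]

end MvPolynomial

open MvPolynomial in
/-- If the coefficients of the polarization of `P` are multiples of powers of `h`, then `P` factors
through `h`. -/
theorem exists_factorization_of_common_root {n : ℕ} {B : Finset (Fin n →₀ ℕ)}
    {q : (Fin n →₀ ℕ) → MvPolynomial (Fin n) ℂ} {P : (Fin n → ℂ) → ℝ} {d e : ℕ}
    (hP : ∀ z, (P z : ℂ) = polar B q z fun i => conj (z i))
    (hconst : ∃ z, P z ≠ 0) (hpsh : IsPlurisubharmonic P)
    (hB : ∀ β ∈ B, 0 < β.degree ∧ β.degree < d)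
    {h : MvPolynomial (Fin n) ℂ} (he : 0 < e) (hh : h.IsHomogeneous e) (hh0 : h ≠ 0)
    {c : (Fin n →₀ ℕ) → ℂ} {m : (Fin n →₀ ℕ) → ℕ}
    (hq : ∀ β ∈ B, q β = C (c β) * h ^ m β ∧ d - β.degree = e * m β) :
    ∃ s : ℂ → ℝ, (IsPolynomialFun (toFinOne s) ∧ IsRealHomogeneous (toFinOne s) ∧ IsSubharmonic s ∧
        HasNoPluriharmonicTerms (toFinOne s)) ∧ ∀ z : Fin n → ℂ, P z = s (eval z h) := by
  obtain ⟨w₀, hw₀⟩ : ∃ w, eval w h = 1 := by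
    obtain ⟨z, hz⟩ : ∃ z, eval z h ≠ 0 := by
      by_contra! hne
      exact hh0 (MvPolynomial.funext fun z => by simpa using hne z)
    obtain ⟨t, ht⟩ := IsAlgClosed.exists_pow_nat_eq (eval z h)⁻¹ he
    exact ⟨t • z, by rw [hh.eval_smul, ht, inv_mul_cancel₀ hz]⟩
  have heval : ∀ ζ : ℂ, eval (ζ • w₀) h = ζ ^ e := fun ζ => by rw [hh.eval_smul, hw₀, mul_one]
  have hfib : ∀ z z', eval z h = eval z' h → P z = P z' := fun z z' hz =>
    eq_of_forall_eval_eq hP fun β hβ => by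
      rw [(hq β hβ).1, map_mul, map_mul, map_pow, map_pow, hz, eval_C, eval_C]
  have hPw : ∀ ζ : ℂ, (P (ζ • w₀) : ℂ) = ∑ β ∈ B,
      (c β * conj (eval w₀ (monomial β 1))) * ((ζ ^ e) ^ m β * conj ζ ^ β.degree) := by
    intro ζ
    rw [ofReal_eq_sum_eval_mul_conj hP]
    refine Finset.sum_congr rfl fun β hβ => ?_
    rw [(hq β hβ).1, map_mul, map_pow, heval, eval_C,
      (isHomogeneous_monomial (1 : ℂ) (rfl : β.degree = β.degree)).eval_smul, map_mul, map_pow]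
    ring
  -- Rotating `ζ` by a primitive `e`-th root of unity `ω` preserves `h (ζ w₀) = ζ ^ e`, hence `P`,
  -- yet multiplies `P` by `conj ω ^ d`. As `P` is nonzero somewhere, `ω ^ d = 1`.
  obtain ⟨N, rfl⟩ : e ∣ d := by
    by_contra hed
    obtain ⟨z, hz⟩ := hconst
    obtain ⟨ζ, hζ⟩ := IsAlgClosed.exists_pow_nat_eq (eval z h) he
    have hω := Complex.isPrimitiveRoot_exp e he.ne'
    set ω := Complex.exp (2 * Real.pi * Complex.I / e)
    have h1 : P (ζ • w₀) = P z := hfib _ _ (by rw [heval, hζ])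
    have h2 : P ((ω * ζ) • w₀) = P z := hfib _ _ (by
      rw [heval, mul_pow, hω.pow_eq_one, one_mul, hζ])
    have h3 : (P ((ω * ζ) • w₀) : ℂ) = conj ω ^ d * P (ζ • w₀) := by
      rw [hPw, hPw, Finset.mul_sum]
      refine Finset.sum_congr rfl fun β hβ => ?_
      have h4 : conj ω ^ d = conj ω ^ β.degree := by
        have h5 : d = e * m β + β.degree := by
          have := (hq β hβ).2
          have := (hB β hβ).2
          omega
        rw [h5, pow_add, pow_mul, ← map_pow, hω.pow_eq_one, map_one, one_pow, one_mul]
      rw [h4, mul_pow ω, hω.pow_eq_one, map_mul]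
      ring
    rw [h1, h2] at h3
    have h6 : conj ω ^ d = 1 := by
      have hz' : (P z : ℂ) ≠ 0 := by exact_mod_cast hz
      exact mul_right_cancel₀ hz' (by rw [← h3, one_mul])
    rw [← map_pow] at h6
    have h7 : ω ^ d = 1 := by simpa using congrArg conj h6
    exact hed (hω.dvd_of_pow_eq_one d h7)
  have hdeg : ∀ β ∈ B, 0 < m β ∧ m β < N ∧ β.degree = e * (N - m β) := by
    intro β hβ
    have h1 := (hq β hβ).2
    have h2 := hB β hβ
    have h3 : 0 < m β := by
      rcases Nat.eq_zero_or_pos (m β) with h | h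
      · rw [h] at h1
        omega
      · exact h
    have h4 : e * m β < e * N := by omega
    have h5 := Nat.lt_of_mul_lt_mul_left h4
    refine ⟨h3, h5, ?_⟩
    rw [Nat.mul_sub]
    omega
  set a : (Fin n →₀ ℕ) → ℂ := fun β => c β * conj (eval w₀ (monomial β 1)) with ha
  set S : ℂ → ℂ := fun w => ∑ β ∈ B, a β * (w ^ m β * conj w ^ (N - m β)) with hS
  have hPS : ∀ ζ : ℂ, (P (ζ • w₀) : ℂ) = S (ζ ^ e) := fun ζ => by
    rw [hPw]
    refine Finset.sum_congr rfl fun β hβ => ?_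
    rw [(hdeg β hβ).2.2, pow_mul (conj ζ), map_pow]
  set s : ℂ → ℝ := fun w => (S w).re with hs_def
  -- Taking real parts loses nothing: every `w` is some `ζ ^ e`, where `S` equals the real number `P
  -- (ζ w₀)`.
  have hs : ∀ w, (s w : ℂ) = S w := fun w => by
    obtain ⟨ζ, rfl⟩ := IsAlgClosed.exists_pow_nat_eq w he
    simp only [hs_def, ← hPS, Complex.ofReal_re]
  have hsP : ∀ ζ : ℂ, s (ζ ^ e) = P (ζ • w₀) := fun ζ => by
    apply Complex.ofReal_injective
    rw [hs, hPS]
  have hterms : HasNoPluriharmonicTerms (toFinOne s) := by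
    refine ⟨∑ β ∈ B, monomial (Finsupp.single (Sum.inl 0) (m β) +
      Finsupp.single (Sum.inr 0) (N - m β)) (a β), fun w => ?_, fun k hk => ?_⟩
    · rw [toFinOne, hs, evalConj, map_sum]
      refine Finset.sum_congr rfl fun β _ => ?_
      rw [eval_monomial, Finsupp.prod_add_index' (by simp) (by simp [pow_add]),
        Finsupp.prod_single_index (by simp), Finsupp.prod_single_index (by simp)]
      rfl
    · rw [mem_support_iff, coeff_sum] at hk
      obtain ⟨β, hβ, hne⟩ := Finset.exists_ne_zero_of_sum_ne_zero hk
      rw [coeff_monomial] at hne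
      have hk' := (ite_ne_right_iff.1 hne).1
      obtain ⟨h1, h2, -⟩ := hdeg β hβ
      rw [← hk']
      refine ⟨⟨0, ?_⟩, ⟨0, ?_⟩⟩
      · simp
        omega
      · simp
        omega
  refine ⟨s, ⟨⟨_, hterms.choose_spec.1⟩, ⟨N, fun t w => ?_⟩, ?_, hterms⟩, fun z => ?_⟩
  · apply Complex.ofReal_injective
    rw [Complex.ofReal_mul, toFinOne, toFinOne, hs, hs, hS, Finset.mul_sum]
    refine Finset.sum_congr rfl fun β hβ => ?_
    obtain ⟨k, hk⟩ := Nat.exists_eq_add_of_lt (hdeg β hβ).2.1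
    have hk1 : N - m β = k + 1 := by omega
    rw [hk1, Complex.ofReal_pow, show N = m β + (k + 1) by omega]
    simp only [Pi.smul_apply, smul_eq_mul, map_mul, Complex.conj_ofReal, mul_pow]
    ring
  · refine isSubharmonic_of_subMean_comp_pow (B := B)
      (f := fun β => Polynomial.C (a β) * Polynomial.X ^ m β)
      (g := fun β => Polynomial.X ^ (N - m β)) (e := e) (fun w => ?_) he (fun ζ r hr => ?_)
    · rw [hs]
      refine Finset.sum_congr rfl fun β _ => ?_
      simp [mul_assoc]
    · simp_rw [hsP, add_smul]
      simpa using ((hpsh.2 (ζ • w₀) w₀).2 0 r hr).2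
  · obtain ⟨ζ, hζ⟩ := IsAlgClosed.exists_pow_nat_eq (eval z h) he
    rw [← hζ, hsP]
    exact hfib _ _ (by rw [heval, hζ])

/-! ### Assembly of the main theorem. -/

open MvPolynomial in
theorem mainTheorem3 (n : ℕ) (hn : 2 ≤ n) (P : (Fin n → ℂ) → ℝ)
    (hpoly : IsPolynomialFun P) (hconst : ∃ z w, P z ≠ P w)
    (hhom : IsRealHomogeneous P) (hpsh : IsPlurisubharmonic P)
    (hterms : HasNoPluriharmonicTerms P)
    (hG : ∃ G : (Fin n → ℂ) → ℂ, Differentiable ℂ G ∧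
      ∃ U : Set (Fin n → ℂ), IsOpen U ∧ U.Nonempty ∧ (∀ z ∈ U, fderiv ℂ G z ≠ 0) ∧
        ∀ c : ℂ, IsPluriharmonicAlong P {z | z ∈ U ∧ G z = c}) :
    ∃ s : ℂ → ℝ, ∃ h : MvPolynomial (Fin n) ℂ,
      (IsPolynomialFun (toFinOne s) ∧ IsRealHomogeneous (toFinOne s) ∧ IsSubharmonic s ∧
        HasNoPluriharmonicTerms (toFinOne s)) ∧
      (∃ d : ℕ, h.IsHomogeneous d) ∧
      ∀ z : Fin n → ℂ, P z = s (MvPolynomial.eval z h) := by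
  obtain ⟨p, hp, hpterms⟩ := hterms
  obtain ⟨d, hd⟩ := hhom
  obtain ⟨G, hG, U, hU, hne, hGz, hharm⟩ := hG
  obtain ⟨B, q, hpolar, hB⟩ := exists_eq_polar (isHomogeneous_of_isRealHomogeneous hp hd) hpterms
  have hP : ∀ z, (P z : ℂ) = polar B q z fun i => conj (z i) := fun z => by
    rw [hp, evalConj, hpolar]
  have hgrad := fun j l z β (hβ : β ∈ B) => fderiv_mul_pderiv_eq hP hpsh
    (fun β hβ => (hB β hβ).1) hG hU hne hGz hharm j l z hβ
  have hprop : ∀ β ∈ B, ∀ β' ∈ B, ∀ j l,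
      pderiv j (q β) * pderiv l (q β') = pderiv l (q β) * pderiv j (q β') := by
    intro β hβ β' hβ' j l
    refine eq_of_eval_eq_on_open hU hne fun z hz => ?_
    obtain ⟨k, hk⟩ : ∃ k, fderiv ℂ G z (Pi.single k 1) ≠ 0 := by
      by_contra! h0
      refine hGz z hz (ContinuousLinearMap.coe_injective (LinearMap.pi_ext' fun i => ?_))
      ext
      simpa using h0 i
    -- Both gradients are proportional to `dG`; multiplying by the square of a nonvanishing
    -- component of `dG` exposes this.
    refine mul_left_cancel₀ (mul_ne_zero hk hk) ?_
    have h1 := hgrad j k z β hβ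
    have h2 := hgrad l k z β hβ
    have h3 := hgrad j k z β' hβ'
    have h4 := hgrad l k z β' hβ'
    simp only [map_mul]
    set g := fderiv ℂ G z (Pi.single k 1)
    calc g * g * (eval z (pderiv j (q β)) * eval z (pderiv l (q β')))
        = (g * eval z (pderiv j (q β))) * (g * eval z (pderiv l (q β'))) := by ring
      _ = (g * eval z (pderiv l (q β))) * (g * eval z (pderiv j (q β'))) := by
        rw [h1, h2, h3, h4]
        ring
      _ = _ := by ring
  have hPne : ∃ z, P z ≠ 0 := by
    obtain ⟨z, w, hzw⟩ := hconst
    by_contra! h0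
    exact hzw (by rw [h0, h0])
  obtain ⟨β₀, hβ₀⟩ : B.Nonempty := by
    rw [Finset.nonempty_iff_ne_empty]
    rintro rfl
    obtain ⟨z, hz⟩ := hPne
    apply hz
    apply Complex.ofReal_injective
    rw [hP, polar, Finset.sum_empty, Complex.ofReal_zero]
  obtain ⟨-, h2, h3, h4⟩ := hB β₀ hβ₀
  -- One fixed coefficient `q β₀` serves as reference: every `q β` has a power proportional to a
  -- power of it.
  obtain ⟨h, e, he, hh, hh0, hroot⟩ := exists_common_root (Nat.sub_pos_of_lt h2) h3 h4
  have hex : ∀ β, ∃ (c : ℂ) (m : ℕ), β ∈ B → q β = C c * h ^ m ∧ d - β.degree = e * m := by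
    intro β
    by_cases hβ : β ∈ B
    · obtain ⟨-, hβ2, hβ3, hβ4⟩ := hB β hβ
      obtain ⟨c, hc, hpow⟩ := hβ3.exists_pow_eq_C_mul_pow h3 (Nat.sub_pos_of_lt hβ2)
        (Nat.sub_pos_of_lt h2) hβ4 h4 (hprop β hβ β₀ hβ₀)
      obtain ⟨c', m, hcm⟩ := hroot _ _ c hβ3 hc hpow
      exact ⟨c', m, fun _ => hcm⟩
    · exact ⟨0, 0, fun h => absurd h hβ⟩
  choose c m hcm using hex
  obtain ⟨s, hs, hPs⟩ := exists_factorization_of_common_root hP hPne hpsh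
    (fun β hβ => ⟨(hB β hβ).1, (hB β hβ).2.1⟩) he hh hh0 hcm
  exact ⟨s, h, hs, ⟨e, hh⟩, hPs⟩
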